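/- Let $\Bbbk$ be an algebraically closed field of characteristic zero; all algebras and isomorphisms are over $\Bbbk$. Let $f, f' \in \Bbbk\langle x,y\rangle$ be (not necessarily homogeneous) polynomials of degree exactly two in two noncommuting variables, and let $A = \Bbbk\langle x,y \mid f\rangle$ and $A' = \Bbbk\langle x,y \mid f'\rangle$. Let $H(A) = \Bbbk\langle x,y,z \mid xz-zx,\ yz-zy,\ \hat f\rangle$ be the homogenization of $A$, where $\hat f$ is obtained from $f$ by multiplying each monomial of degree $i$ by $z^{2-i}$, and define $H(A')$ in the same way from $f'$. Let $\operatorname{gr}(A) = \bigoplus_{n\ge 0} F_n/F_{n-1}$ be the associated graded algebra of $A$, where $F_n \subseteq A$ is the span of all products of at most $n$ of the generators $x,y$ (and $F_{-1}=0$), and define $\operatorname{gr}(A')$ in the same way. Suppose that $A$ and $A'$ have trivial center, that is, $\mathcal{Z}(A) = \mathcal{Z}(A') = \Bbbk$. If $H(A) \cong H(A')$, then either $A \cong A'$ and $\operatorname{gr}(A) \cong \operatorname{gr}(A')$, or else $A \cong \operatorname{gr}(A')$ and $A' \cong \operatorname{gr}(A)$. -/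

import Mathlib

noncomputable section

namespace TwoGen

universe u v w

/-! ### Presented algebras -/

/-- The algebra `k⟨X | R⟩` with generators `X` and relations `r = 0` for `r ∈ R`. -/
abbrev Presented (k : Type u) [Field k] {X : Type v} (R : Set (FreeAlgebra k X)) : Type (max u v) :=
  RingQuot (fun a b : FreeAlgebra k X => a ∈ R ∧ b = 0)

/-- The coefficient of the word `w` in the noncommutative polynomial `f`. -/
def coeff {k : Type u} [Field k] {X : Type v} (f : FreeAlgebra k X) (w : FreeMonoid X) : k :=
  (FreeAlgebra.equivMonoidAlgebraFreeMonoid f).coeff w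

/-- The finite set of words that occur in `f` with nonzero coefficient. -/
def words {k : Type u} [Field k] {X : Type v} (f : FreeAlgebra k X) : Finset (FreeMonoid X) :=
  (FreeAlgebra.equivMonoidAlgebraFreeMonoid f).coeff.support

/-- The total degree of a noncommutative polynomial: the largest length of a word that occurs
in it (`0` for the zero polynomial). -/
def degree {k : Type u} [Field k] {X : Type v} (f : FreeAlgebra k X) : ℕ :=
  (words f).sup FreeMonoid.length

/-- The algebra `k⟨x, y | f⟩`, with `x`, `y` the generators of index `0`, `1`. -/
abbrev Alg {k : Type u} [Field k] (f : FreeAlgebra k (Fin 2)) : Type u :=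
  Presented k {f}

/-- The images of the generators `x`, `y` in `k⟨x, y | f⟩`. -/
def gen {k : Type u} [Field k] (f : FreeAlgebra k (Fin 2)) (i : Fin 2) : Alg f :=
  RingQuot.mkAlgHom k (fun a b : FreeAlgebra k (Fin 2) => a ∈ ({f} : Set _) ∧ b = 0)
    (FreeAlgebra.ι k i)

/-! ### Homogenization -/

/-- The homogenization in `k⟨x, y, z⟩` (generators of index `0`, `1`, `2`) of a noncommutative
polynomial `f` in `x`, `y`: each word `w` of `f` is multiplied by `z ^ (degree f - length w)`. -/
def homogenize {k : Type u} [Field k] (f : FreeAlgebra k (Fin 2)) : FreeAlgebra k (Fin 3) :=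
  ∑ w ∈ words f, coeff f w •
    (FreeMonoid.lift (fun i : Fin 2 => FreeAlgebra.ι k i.castSucc) w *
      FreeAlgebra.ι k (2 : Fin 3) ^ (degree f - w.length))

/-- The homogenization `H(A) = k⟨x, y, z | xz - zx, yz - zy, homogenize f⟩` of
`A = k⟨x, y | f⟩`. -/
abbrev HomogAlg {k : Type u} [Field k] (f : FreeAlgebra k (Fin 2)) : Type u :=
  Presented k
    ({FreeAlgebra.ι k (0 : Fin 3) * FreeAlgebra.ι k 2 - FreeAlgebra.ι k 2 * FreeAlgebra.ι k 0,
      FreeAlgebra.ι k (1 : Fin 3) * FreeAlgebra.ι k 2 - FreeAlgebra.ι k 2 * FreeAlgebra.ι k 1,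
      homogenize f} : Set (FreeAlgebra k (Fin 3)))

/-! ### The associated graded algebra of the standard filtration -/

section AssociatedGraded

variable (k : Type u) [Field k] {A : Type v} [Ring A] [Algebra k A] {X : Type w} (g : X → A)

/-- The standard filtration of `A` defined by the elements `g i`: the `n`-th term is the span of
all products of at most `n` of the `g i`, that is, the `n`-th power of the span of `1` and
the `g i`. -/
def filt (n : ℕ) : Submodule k A :=
  Submodule.span k (insert 1 (Set.range g)) ^ n

/-- The term before the `n`-th one in the standard filtration, with `0` before the `0`-th. -/
def filtLT : ℕ → Submodule k A
  | 0 => ⊥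
  | n + 1 => filt k g n

theorem one_mem_filt_zero : (1 : A) ∈ filt k g 0 := by
  simpa [filt] using ⟨1, map_one (algebraMap k A)⟩

theorem mul_mem_filt {i j : ℕ} {a b : A} (ha : a ∈ filt k g i) (hb : b ∈ filt k g j) :
    a * b ∈ filt k g (i + j) := by
  unfold filt at *
  rw [pow_add]
  exact Submodule.mul_mem_mul ha hb

theorem mul_mem_filtLT_left {i j : ℕ} {a b : A} (ha : a ∈ filtLT k g i) (hb : b ∈ filt k g j) :
    a * b ∈ filtLT k g (i + j) := by
  cases i with
  | zero =>
    have h0 : a = 0 := by simpa [filtLT] using ha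
    simp [h0]
  | succ i =>
    rw [show i + 1 + j = (i + j) + 1 by omega]
    exact mul_mem_filt k g ha hb

theorem mul_mem_filtLT_right {i j : ℕ} {a b : A} (ha : a ∈ filt k g i) (hb : b ∈ filtLT k g j) :
    a * b ∈ filtLT k g (i + j) := by
  cases j with
  | zero =>
    have h0 : b = 0 := by simpa [filtLT] using hb
    simp [h0]
  | succ j => exact mul_mem_filt k g ha hb

/-- The graded piece `F_n / F_{n-1}`. -/
def GrPiece (n : ℕ) : Type v :=
  (filt k g n) ⧸ (filtLT k g n).submoduleOf (filt k g n)

instance (n : ℕ) : AddCommGroup (GrPiece k g n) :=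
  inferInstanceAs (AddCommGroup ((filt k g n) ⧸ (filtLT k g n).submoduleOf (filt k g n)))

instance (n : ℕ) : Module k (GrPiece k g n) :=
  inferInstanceAs (Module k ((filt k g n) ⧸ (filtLT k g n).submoduleOf (filt k g n)))

variable {k g}

/-- The class in `F_n / F_{n-1}` of an element of `F_n`. -/
def grMk {n : ℕ} (a : A) (ha : a ∈ filt k g n) : GrPiece k g n :=
  Submodule.Quotient.mk ⟨a, ha⟩

theorem exists_grMk {n : ℕ} (x : GrPiece k g n) :
    ∃ (a : A) (ha : a ∈ filt k g n), grMk a ha = x := by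
  obtain ⟨⟨a, ha⟩, rfl⟩ := Submodule.Quotient.mk_surjective _ x
  exact ⟨a, ha, rfl⟩

theorem grMk_eq_iff {n : ℕ} {a b : A} (ha : a ∈ filt k g n) (hb : b ∈ filt k g n) :
    grMk a ha = grMk b hb ↔ a - b ∈ filtLT k g n :=
  Submodule.Quotient.eq _

theorem grMk_add {n : ℕ} {a b : A} (ha : a ∈ filt k g n) (hb : b ∈ filt k g n) :
    grMk a ha + grMk b hb = grMk (a + b) (add_mem ha hb) := rfl

theorem grMk_zero {n : ℕ} : grMk (k := k) (g := g) (n := n) 0 (zero_mem _) = 0 := rfl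

theorem grMk_smul {n : ℕ} (c : k) {a : A} (ha : a ∈ filt k g n) :
    c • grMk a ha = grMk (c • a) (Submodule.smul_mem _ c ha) := rfl

theorem gradedMonoid_mk_eq {m n : ℕ} (h : m = n) {a b : A} (hab : a = b)
    (ha : a ∈ filt k g m) (hb : b ∈ filt k g n) :
    GradedMonoid.mk (A := GrPiece k g) m (grMk a ha) = GradedMonoid.mk n (grMk b hb) := by
  subst h
  subst hab
  rfl

/-- The multiplication `F_i / F_{i-1} × F_j / F_{j-1} → F_{i+j} / F_{i+j-1}` induced by the one
of `A`. -/
def grMul {i j : ℕ} : GrPiece k g i → GrPiece k g j → GrPiece k g (i + j) :=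
  Quotient.map₂
    (fun a b => ⟨(a : A) * (b : A), mul_mem_filt k g a.2 b.2⟩)
    (by
      intro a a' ha b b' hb
      have ha' : (a : A) - a' ∈ filtLT k g i :=
        (Submodule.quotientRel_def ((filtLT k g i).submoduleOf (filt k g i))).1 ha
      have hb' : (b : A) - b' ∈ filtLT k g j :=
        (Submodule.quotientRel_def ((filtLT k g j).submoduleOf (filt k g j))).1 hb
      refine (Submodule.quotientRel_def _).2 ?_
      change (a : A) * b - a' * b' ∈ filtLT k g (i + j)
      have h : (a : A) * b - a' * b' = (a - a') * b + a' * (b - b') := by noncomm_ring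
      rw [h]
      exact add_mem (mul_mem_filtLT_left k g ha' b.2) (mul_mem_filtLT_right k g a'.2 hb'))

theorem grMul_grMk {i j : ℕ} {a b : A} (ha : a ∈ filt k g i) (hb : b ∈ filt k g j) :
    grMul (grMk a ha) (grMk b hb) = grMk (a * b) (mul_mem_filt k g ha hb) := rfl

instance : GradedMonoid.GMul (GrPiece k g) where
  mul := grMul

instance : GradedMonoid.GOne (GrPiece k g) where
  one := grMk 1 (one_mem_filt_zero k g)

theorem mk_mul_mk {i j : ℕ} {a b : A} (ha : a ∈ filt k g i) (hb : b ∈ filt k g j) :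
    (GradedMonoid.mk i (grMk a ha) * GradedMonoid.mk j (grMk b hb) : GradedMonoid (GrPiece k g)) =
      GradedMonoid.mk (i + j) (grMk (a * b) (mul_mem_filt k g ha hb)) := rfl

theorem algebraMap_mem_filt_zero (c : k) : algebraMap k A c ∈ filt k g 0 := by
  rw [Algebra.algebraMap_eq_smul_one]
  exact Submodule.smul_mem _ _ (one_mem_filt_zero k g)

theorem natCast_mem_filt_zero (n : ℕ) : (n : A) ∈ filt k g 0 := by
  simpa using algebraMap_mem_filt_zero (k := k) (g := g) (n : k)

instance : DirectSum.GSemiring (GrPiece k g) where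
  mul_zero := by
    intro i j x
    obtain ⟨a, ha, rfl⟩ := exists_grMk x
    change grMul (grMk a ha) (grMk 0 (zero_mem _)) = grMk 0 (zero_mem _)
    simp [grMul_grMk]
  zero_mul := by
    intro i j x
    obtain ⟨a, ha, rfl⟩ := exists_grMk x
    change grMul (grMk 0 (zero_mem _)) (grMk a ha) = grMk 0 (zero_mem _)
    simp [grMul_grMk]
  mul_add := by
    intro i j x y z
    obtain ⟨a, ha, rfl⟩ := exists_grMk x
    obtain ⟨b, hb, rfl⟩ := exists_grMk y
    obtain ⟨c, hc, rfl⟩ := exists_grMk z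
    change grMul (grMk a ha) (grMk b hb + grMk c hc) =
      grMul (grMk a ha) (grMk b hb) + grMul (grMk a ha) (grMk c hc)
    simp [grMk_add, grMul_grMk, mul_add]
  add_mul := by
    intro i j x y z
    obtain ⟨a, ha, rfl⟩ := exists_grMk x
    obtain ⟨b, hb, rfl⟩ := exists_grMk y
    obtain ⟨c, hc, rfl⟩ := exists_grMk z
    change grMul (grMk a ha + grMk b hb) (grMk c hc) =
      grMul (grMk a ha) (grMk c hc) + grMul (grMk b hb) (grMk c hc)
    simp [grMk_add, grMul_grMk, add_mul]
  one_mul := by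
    rintro ⟨i, x⟩
    obtain ⟨a, ha, rfl⟩ := exists_grMk x
    exact gradedMonoid_mk_eq (zero_add i) (one_mul a) _ _
  mul_one := by
    rintro ⟨i, x⟩
    obtain ⟨a, ha, rfl⟩ := exists_grMk x
    exact gradedMonoid_mk_eq (add_zero i) (mul_one a) _ _
  mul_assoc := by
    rintro ⟨i, x⟩ ⟨j, y⟩ ⟨l, z⟩
    obtain ⟨a, ha, rfl⟩ := exists_grMk x
    obtain ⟨b, hb, rfl⟩ := exists_grMk y
    obtain ⟨c, hc, rfl⟩ := exists_grMk z
    exact gradedMonoid_mk_eq (add_assoc i j l) (mul_assoc a b c) _ _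
  natCast n := grMk (n : A) (natCast_mem_filt_zero n)
  natCast_zero := by
    rw [← grMk_zero, grMk_eq_iff]
    simp
  natCast_succ := by
    intro n
    change _ = grMk (n : A) (natCast_mem_filt_zero n) + grMk 1 (one_mem_filt_zero k g)
    rw [grMk_add, grMk_eq_iff]
    simp

instance : DirectSum.GAlgebra k (GrPiece k g) where
  toFun :=
    { toFun := fun c => grMk (algebraMap k A c) (algebraMap_mem_filt_zero c)
      map_zero' := by
        rw [← grMk_zero, grMk_eq_iff]
        simp
      map_add' := by
        intro c d
        rw [grMk_add, grMk_eq_iff]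
        simp }
  map_one := by
    change grMk (algebraMap k A 1) _ = grMk 1 _
    rw [grMk_eq_iff]
    simp
  map_mul c d := gradedMonoid_mk_eq (zero_add 0).symm (map_mul (algebraMap k A) c d) _ _
  commutes := by
    rintro c ⟨i, x⟩
    obtain ⟨a, ha, rfl⟩ := exists_grMk x
    exact gradedMonoid_mk_eq (by omega) (Algebra.commutes c a)
      (mul_mem_filt k g (algebraMap_mem_filt_zero c) ha)
      (mul_mem_filt k g ha (algebraMap_mem_filt_zero c))
  smul_def := by
    rintro c ⟨i, x⟩
    obtain ⟨a, ha, rfl⟩ := exists_grMk x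
    exact gradedMonoid_mk_eq (zero_add i).symm (Algebra.smul_def c a)
      (Submodule.smul_mem _ c ha) (mul_mem_filt k g (algebraMap_mem_filt_zero c) ha)

end AssociatedGraded

/-- The associated graded algebra `gr(A) = ⨁ F_n / F_{n-1}` of `A = k⟨x, y | f⟩` with respect to
the standard filtration, in which `x` and `y` have degree one. -/
abbrev Gr {k : Type u} [Field k] (f : FreeAlgebra k (Fin 2)) : Type u :=
  DirectSum ℕ (GrPiece k (gen f))

end TwoGen

end

namespace TwoGen

open Polynomial

universe u v w

/-! View `H(A)` as a family of algebras over the line with coordinate `z`. Since `z` is central, one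
can pass to the fibre `z = l`: it is `A` when `l ≠ 0`, by rescaling the generators, and it is
`gr(A)` when `l = 0`.

The hard point is the map from `H(A)` to `A[t]` with `x ↦ xt`, `y ↦ yt`, `z ↦ t`. Its image is the
Rees algebra of the filtration; once it is injective, the fibre at `0` is `gr(A)`
(`IsQuad.exists_isFibre_gr`), and trivial center of `A` makes the center of `H(A)` equal to `k[z]`
(`exists_aeval_of_mem_center`). An isomorphism `φ` then induces an isomorphism of polynomial rings
`k[z] ≅ k[z']`, so `φ z = s z' + t` with `s ≠ 0` (`exists_eq_linear`). It matches the fibre `z = l`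
with the fibre `z' = l'` whenever `l = s l' + t`. The two alternatives of the theorem are `t = 0`
and `t ≠ 0`.

Injectivity comes from explicit bases. A linear change of variables brings the quadratic part of `f`
to one of two forms (`exists_normalForm`). In the first, `xy` can be rewritten and the monomials `y
^ i x ^ j` form a basis. In the second, the quadratic part is `x ^ 2`; if `y` occurs linearly then
`A` is commutative, contrary to the hypothesis, and otherwise the words without `x ^ 2` form a
basis. -/

/-- The value of the homogeneous quadratic expression
`∑ a i j x_i x_j + ∑ b i x_i z + c z ^ 2`. -/
def quad {k : Type u} [Field k] (a : Matrix (Fin 2) (Fin 2) k) (b : Fin 2 → k) (c : k)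
    {B : Type v} [Semiring B] [Algebra k B] (x : Fin 2 → B) (z : B) : B :=
  ∑ i, ∑ j, a i j • (x i * x j) + ∑ i, b i • (x i * z) + c • (z * z)

/-- The polynomial `f` is the quadratic polynomial with coefficients `a`, `b`, `c`. -/
structure IsQuad {k : Type u} [Field k] (f : FreeAlgebra k (Fin 2))
    (a : Matrix (Fin 2) (Fin 2) k) (b : Fin 2 → k) (c : k) : Prop where
  eq : f = quad a b c (FreeAlgebra.ι k) 1
  homog : homogenize f = quad a b c (fun i : Fin 2 => FreeAlgebra.ι k i.castSucc)
    (FreeAlgebra.ι k (2 : Fin 3))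

/-! ### Coefficients of a quadratic polynomial -/

section Coefficients

variable {k : Type u} [Field k]

theorem quad_map {a : Matrix (Fin 2) (Fin 2) k} {b : Fin 2 → k} {c : k}
    {B : Type v} [Semiring B] [Algebra k B] {C : Type w} [Semiring C] [Algebra k C]
    (φ : B →ₐ[k] C) (x : Fin 2 → B) (z : B) :
    φ (quad a b c x z) = quad a b c (fun i => φ (x i)) (φ z) := by
  simp [quad]

theorem eq_sum_words {X : Type v} (f : FreeAlgebra k X) :
    f = ∑ w ∈ words f, coeff f w • FreeMonoid.lift (FreeAlgebra.ι k) w := by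
  apply FreeAlgebra.equivMonoidAlgebraFreeMonoid.injective
  rw [map_sum]
  have h : ∀ w : FreeMonoid X, FreeAlgebra.equivMonoidAlgebraFreeMonoid (R := k)
      (FreeMonoid.lift (FreeAlgebra.ι k) w) = MonoidAlgebra.single w 1 := by
    intro w
    induction w using FreeMonoid.inductionOn' with
    | one => simp [MonoidAlgebra.one_def]
    | of_mul x xs ih =>
      rw [map_mul, map_mul, ih]
      simp [FreeAlgebra.equivMonoidAlgebraFreeMonoid, MonoidAlgebra.single_mul_single]
  simp only [map_smul, h, words, coeff]
  apply MonoidAlgebra.coeff_injective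
  rw [MonoidAlgebra.coeff_sum]
  simp only [MonoidAlgebra.coeff_smul, MonoidAlgebra.coeff_single, Finsupp.smul_single,
    smul_eq_mul, mul_one]
  exact (Finsupp.sum_single _).symm

instance : DecidableEq (FreeMonoid (Fin 2)) := inferInstanceAs (DecidableEq (List (Fin 2)))

theorem sum_words_of_degree_eq_two {M : Type w} [AddCommMonoid M] [Module k M]
    {f : FreeAlgebra k (Fin 2)} (hf : degree f = 2) (F : FreeMonoid (Fin 2) → M) :
    ∑ w ∈ words f, coeff f w • F w =
      ∑ i, ∑ j, coeff f (.of i * .of j) • F (.of i * .of j) + ∑ i, coeff f (.of i) • F (.of i) +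
        coeff f 1 • F 1 := by
  let W : Finset (FreeMonoid (Fin 2)) :=
    {.of 0 * .of 0, .of 0 * .of 1, .of 1 * .of 0, .of 1 * .of 1, .of 0, .of 1, 1}
  have h0 : 1 ∈ W := by decide
  have h1 : ∀ i : Fin 2, .of i ∈ W := by decide
  have h2 : ∀ i j : Fin 2, .of i * .of j ∈ W := by decide
  have hW : words f ⊆ W := by
    intro w hw
    have hlen : w.length ≤ 2 :=
      (Finset.le_sup (f := FreeMonoid.length) hw).trans_eq hf
    match w, hlen with
    | [], _ => exact h0
    | [i], _ => exact h1 i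
    | [i, j], _ => exact h2 i j
  rw [Finset.sum_subset hW]
  · rw [Finset.sum_insert (by decide), Finset.sum_insert (by decide),
      Finset.sum_insert (by decide), Finset.sum_insert (by decide), Finset.sum_insert (by decide),
      Finset.sum_insert (by decide), Finset.sum_singleton]
    simp only [Fin.sum_univ_two]
    abel
  · intro w _ hw
    have h0 : coeff f w = 0 := Finsupp.notMem_support_iff.1 hw
    rw [h0, zero_smul]

theorem exists_isQuad {f : FreeAlgebra k (Fin 2)} (hf : degree f = 2) :
    ∃ a b c, a ≠ 0 ∧ IsQuad f a b c := by
  refine ⟨Matrix.of fun i j => coeff f (.of i * .of j), fun i => coeff f (.of i), coeff f 1,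
    ?_, ?_, ?_⟩
  · intro h0
    obtain ⟨w, hw, hw2⟩ := Finset.exists_mem_eq_sup (words f) (by
      rw [Finset.nonempty_iff_ne_empty]
      intro h
      simp [degree, h] at hf) FreeMonoid.length
    have h2 : w.length = 2 := hw2.symm.trans hf
    match w, h2 with
    | [i, j], _ => exact Finsupp.mem_support_iff.1 hw (congrFun (congrFun h0 i) j)
  · conv_lhs => rw [eq_sum_words f, sum_words_of_degree_eq_two hf]
    simp [quad]
  · rw [homogenize, sum_words_of_degree_eq_two hf]
    simp [quad, hf, FreeMonoid.length_mul, pow_two]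

end Coefficients

/-! ### Generators and universal properties -/

section Generators

variable {k : Type u} [Field k] (f : FreeAlgebra k (Fin 2))

/-- The images of the generators `x`, `y` in the homogenization. -/
def hgen (i : Fin 2) : HomogAlg f := RingQuot.mkAlgHom k _ (FreeAlgebra.ι k i.castSucc)

/-- The image of the generator `z` in the homogenization. -/
def hz : HomogAlg f := RingQuot.mkAlgHom k _ (FreeAlgebra.ι k (2 : Fin 3))

variable {f} {a : Matrix (Fin 2) (Fin 2) k} {b : Fin 2 → k} {c : k}

theorem mkAlgHom_eq_zero {X : Type v} {R : Set (FreeAlgebra k X)} {r : FreeAlgebra k X}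
    (hr : r ∈ R) : RingQuot.mkAlgHom k (fun a b : FreeAlgebra k X => a ∈ R ∧ b = 0) r = 0 := by
  rw [← map_zero (RingQuot.mkAlgHom k (fun a b : FreeAlgebra k X => a ∈ R ∧ b = 0))]
  exact RingQuot.mkAlgHom_rel k ⟨hr, rfl⟩

theorem IsQuad.quad_gen (h : IsQuad f a b c) : quad a b c (gen f) 1 = 0 := by
  have h1 := mkAlgHom_eq_zero (Set.mem_singleton f)
  have h2 := congrArg (RingQuot.mkAlgHom k (fun a b : FreeAlgebra k (Fin 2) =>
    a ∈ ({f} : Set _) ∧ b = 0)) h.eq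
  rw [quad_map, map_one] at h2
  exact h2.symm.trans h1

theorem IsQuad.quad_hgen (h : IsQuad f a b c) : quad a b c (hgen f) (hz f) = 0 := by
  have h1 := mkAlgHom_eq_zero (k := k) (R :=
    {FreeAlgebra.ι k (0 : Fin 3) * FreeAlgebra.ι k 2 - FreeAlgebra.ι k 2 * FreeAlgebra.ι k 0,
      FreeAlgebra.ι k (1 : Fin 3) * FreeAlgebra.ι k 2 - FreeAlgebra.ι k 2 * FreeAlgebra.ι k 1,
      homogenize f}) (r := homogenize f) (by simp)
  have h2 := congrArg (RingQuot.mkAlgHom k (fun a b : FreeAlgebra k (Fin 3) => a ∈ ({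
      FreeAlgebra.ι k (0 : Fin 3) * FreeAlgebra.ι k 2 - FreeAlgebra.ι k 2 * FreeAlgebra.ι k 0,
      FreeAlgebra.ι k (1 : Fin 3) * FreeAlgebra.ι k 2 - FreeAlgebra.ι k 2 * FreeAlgebra.ι k 1,
      homogenize f} : Set _) ∧ b = 0)) h.homog
  rw [quad_map] at h2
  exact h2.symm.trans h1

theorem hgen_mul_hz (i : Fin 2) : hgen f i * hz f = hz f * hgen f i := by
  have h1 := mkAlgHom_eq_zero (k := k) (R :=
    {FreeAlgebra.ι k (0 : Fin 3) * FreeAlgebra.ι k 2 - FreeAlgebra.ι k 2 * FreeAlgebra.ι k 0,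
      FreeAlgebra.ι k (1 : Fin 3) * FreeAlgebra.ι k 2 - FreeAlgebra.ι k 2 * FreeAlgebra.ι k 1,
      homogenize f})
    (r := FreeAlgebra.ι k i.castSucc * FreeAlgebra.ι k 2
      - FreeAlgebra.ι k 2 * FreeAlgebra.ι k i.castSucc) (by fin_cases i <;> simp)
  rw [map_sub, map_mul, map_mul, sub_eq_zero] at h1
  exact h1

theorem IsQuad.exists_lift (h : IsQuad f a b c) {B : Type v} [Semiring B] [Algebra k B]
    (x : Fin 2 → B) (hx : quad a b c x 1 = 0) :
    ∃ φ : Alg f →ₐ[k] B, ∀ i, φ (gen f i) = x i := by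
  refine ⟨RingQuot.liftAlgHom k ⟨FreeAlgebra.lift k x, ?_⟩, ?_⟩
  · rintro _ _ ⟨rfl, rfl⟩
    rw [h.eq, quad_map]
    simpa using hx
  · intro i
    simp [gen]

theorem IsQuad.exists_hlift (h : IsQuad f a b c) {B : Type v} [Semiring B] [Algebra k B]
    (x : Fin 2 → B) (z : B) (hz' : ∀ i, x i * z = z * x i) (hx : quad a b c x z = 0) :
    ∃ φ : HomogAlg f →ₐ[k] B, (∀ i, φ (hgen f i) = x i) ∧ φ (hz f) = z := by
  refine ⟨RingQuot.liftAlgHom k ⟨FreeAlgebra.lift k ![x 0, x 1, z], ?_⟩, ?_, ?_⟩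
  · rintro r _ ⟨hr, rfl⟩
    -- `B` is only a semiring, so the difference is handled through the scalar `-1`.
    have hadd : ∀ p q : FreeAlgebra k (Fin 3), FreeAlgebra.lift k ![x 0, x 1, z] p =
        FreeAlgebra.lift k ![x 0, x 1, z] q → FreeAlgebra.lift k ![x 0, x 1, z] (p - q) =
          FreeAlgebra.lift k ![x 0, x 1, z] 0 := by
      intro p q hpq
      have h0 : (-1 : k) • FreeAlgebra.lift k ![x 0, x 1, z] q +
          FreeAlgebra.lift k ![x 0, x 1, z] q = 0 := by
        rw [← map_smul, ← map_add]
        simp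
      rw [sub_eq_add_neg, ← neg_one_smul k q, map_add, map_smul, hpq, add_comm, h0, map_zero]
    rcases hr with rfl | rfl | rfl
    · exact hadd _ _ (by simpa using hz' 0)
    · exact hadd _ _ (by simpa using hz' 1)
    · rw [h.homog, quad_map, map_zero, ← hx]
      congr 1
      · funext i
        fin_cases i <;> simp
      · simp
  · intro i
    fin_cases i <;> simp [hgen]
  · simp [hz]

theorem homogAlg_hom_ext {B : Type v} [Semiring B] [Algebra k B] {φ ψ : HomogAlg f →ₐ[k] B}
    (h : ∀ i, φ (hgen f i) = ψ (hgen f i)) (hh : φ (hz f) = ψ (hz f)) : φ = ψ := by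
  apply RingQuot.ringQuot_ext'
  apply FreeAlgebra.hom_ext
  funext i
  fin_cases i
  exacts [h 0, h 1, hh]

theorem adjoin_gen : Algebra.adjoin k (Set.range (gen f)) = ⊤ := by
  have h : Set.range (gen f) = RingQuot.mkAlgHom k (fun a b : FreeAlgebra k (Fin 2) =>
      a ∈ ({f} : Set _) ∧ b = 0) '' Set.range (FreeAlgebra.ι k) := by
    rw [← Set.range_comp]
    rfl
  rw [h, ← AlgHom.map_adjoin, FreeAlgebra.adjoin_range_ι, Algebra.map_top,
    AlgHom.range_eq_top]
  exact RingQuot.mkAlgHom_surjective k _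

theorem adjoin_hgen : Algebra.adjoin k (insert (hz f) (Set.range (hgen f))) = ⊤ := by
  rw [eq_top_iff, ← (AlgHom.range_eq_top _).2 (RingQuot.mkAlgHom_surjective k _),
    ← Algebra.map_top, ← FreeAlgebra.adjoin_range_ι, AlgHom.map_adjoin, ← Set.range_comp]
  apply Algebra.adjoin_mono
  rintro _ ⟨i, rfl⟩
  fin_cases i
  exacts [.inr ⟨0, rfl⟩, .inr ⟨1, rfl⟩, .inl rfl]

theorem commute_hz (h : HomogAlg f) : Commute (hz f) h := by
  have hh : h ∈ Algebra.adjoin k (insert (hz f) (Set.range (hgen f))) := by simp [adjoin_hgen]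
  induction hh using Algebra.adjoin_induction with
  | mem x hx =>
    rcases hx with rfl | ⟨i, rfl⟩
    exacts [Commute.refl _, (hgen_mul_hz i).symm]
  | algebraMap r => exact (Algebra.commutes r _).symm
  | add x y _ _ hx hy => exact hx.add_right hy
  | mul x y _ _ hx hy => exact hx.mul_right hy

end Generators

/-! ### Fibres of the homogenization over the `z`-line -/

section Fibres

variable {k : Type u} [Field k] {f : FreeAlgebra k (Fin 2)} {a : Matrix (Fin 2) (Fin 2) k}
  {b : Fin 2 → k} {c : k}

theorem quad_mul_right {B : Type v} [Semiring B] [Algebra k B] (x : Fin 2 → B) (t : B)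
    (ht : ∀ i, Commute t (x i)) :
    quad a b c (fun i => x i * t) t = quad a b c x 1 * (t * t) := by
  have h : ∀ i j, x i * t * (x j * t) = x i * x j * (t * t) := fun i j => by
    rw [mul_assoc, ← mul_assoc t, (ht j).eq, mul_assoc, mul_assoc]
  simp only [quad, add_mul, Finset.sum_mul, h, smul_mul_assoc, one_mul, mul_one, mul_assoc]

/-- The canonical map from the homogenization to the Rees algebra inside `A[t]`. -/
theorem IsQuad.exists_toRees (h : IsQuad f a b c) :
    ∃ θ : HomogAlg f →ₐ[k] (Alg f)[X], (∀ i, θ (hgen f i) = C (gen f i) * X) ∧ θ (hz f) = X := by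
  apply h.exists_hlift
  · intro i
    rw [← mul_assoc, X_mul_C, mul_assoc]
  · rw [quad_mul_right _ _ fun i => X_mul_C _]
    have h1 := quad_map (a := a) (b := b) (c := c) (CAlgHom (R := k) (A := Alg f)) (gen f) 1
    rw [h.quad_gen, map_zero, map_one] at h1
    simp only [CAlgHom_apply] at h1
    rw [← h1, zero_mul]

/-- The algebra map `π` realizes its codomain as the quotient of the homogenization by `z - l`. -/
structure IsFibre {B : Type v} [Semiring B] [Algebra k B] (l : k)
    (π : HomogAlg f →ₐ[k] B) : Prop where
  surjective : Function.Surjective π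
  eq_iff : ∀ g h, π g = π h ↔ ∃ e, g - h = (hz f - algebraMap k _ l) * e

/-- By homogeneity, `x i ↦ l x i`, `z ↦ l` multiplies the relation of `A` by `l ^ 2`, so it defines
`π`. The inverse rescaling defines a map `σ` from `A` to the quotient by `z - l`, and `σ ∘ π` is the
quotient map; this bounds the kernel of `π`. -/
theorem IsQuad.exists_isFibre_alg (hq : IsQuad f a b c) {l : k} (hl : l ≠ 0) :
    ∃ π : HomogAlg f →ₐ[k] Alg f, IsFibre l π := by
  obtain ⟨π, hπ, hπz⟩ := hq.exists_hlift (fun i => gen f i * algebraMap k _ l)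
    (algebraMap k (Alg f) l) (fun i => (Algebra.commutes _ _).symm) (by
      rw [quad_mul_right _ _ fun i => Algebra.commutes _ _, hq.quad_gen, zero_mul])
  let I : Ideal (HomogAlg f) := Ideal.span {hz f - algebraMap k _ l}
  -- The left ideal generated by `z - l` is two-sided because `z` is central.
  have hI : I.IsTwoSided := ⟨by
    intro x y hx
    obtain ⟨e, rfl⟩ := Ideal.mem_span_singleton'.1 hx
    refine Ideal.mem_span_singleton'.2 ⟨e * y, ?_⟩
    rw [mul_assoc, mul_assoc, sub_mul, mul_sub, (commute_hz y).eq, Algebra.commutes]⟩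
  have hz1 : Ideal.Quotient.mkₐ k I (hz f) = algebraMap k _ l := by
    rw [← AlgHom.commutes (Ideal.Quotient.mkₐ k I)]
    exact Ideal.Quotient.eq.2 (Ideal.subset_span rfl)
  obtain ⟨σ, hσ⟩ := hq.exists_lift
    (fun i => Ideal.Quotient.mkₐ k I (hgen f i) * algebraMap k _ l⁻¹) (by
      have h1 := quad_mul_right (a := a) (b := b) (c := c)
        (fun i => Ideal.Quotient.mkₐ k I (hgen f i) * algebraMap k _ l⁻¹)
        (algebraMap k (HomogAlg f ⧸ I) l) (fun i => Algebra.commutes _ _)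
      have h2 := congrArg (Ideal.Quotient.mkₐ k I) hq.quad_hgen
      rw [quad_map, hz1, map_zero] at h2
      simp only [mul_assoc, ← map_mul, inv_mul_cancel₀ hl, map_one, mul_one] at h1
      rw [h2] at h1
      have h3 := congrArg (· * algebraMap k (HomogAlg f ⧸ I) (l * l)⁻¹) h1
      simpa [mul_assoc, ← map_mul, hl, -mul_inv_rev] using h3.symm)
  have hσπ : σ.comp π = Ideal.Quotient.mkₐ k I := by
    apply homogAlg_hom_ext
    · intro i
      simp only [AlgHom.comp_apply, hπ, map_mul, hσ, AlgHom.commutes, mul_assoc]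
      simp [← map_mul, hl]
    · simp only [AlgHom.comp_apply, hπz, hz1, AlgHom.commutes]
  refine ⟨π, ?_, ?_⟩
  · rw [← AlgHom.range_eq_top, eq_top_iff, ← adjoin_gen, Algebra.adjoin_le_iff]
    rintro _ ⟨i, rfl⟩
    refine ⟨hgen f i * algebraMap k _ l⁻¹, ?_⟩
    change π _ = _
    rw [map_mul, hπ, AlgHom.commutes, mul_assoc, ← map_mul, mul_inv_cancel₀ hl, map_one, mul_one]
  · intro g h
    constructor
    · intro hgh
      have h1 := congrArg σ hgh
      rw [← AlgHom.comp_apply, ← AlgHom.comp_apply, hσπ] at h1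
      obtain ⟨e, he⟩ := Ideal.mem_span_singleton'.1 (Ideal.Quotient.eq.1 h1)
      refine ⟨e, ?_⟩
      rw [← he, sub_mul, mul_sub, (commute_hz e).eq, Algebra.commutes]
    · rintro ⟨e, he⟩
      rw [← sub_eq_zero, ← map_sub, he, map_mul, map_sub, hπz, AlgHom.commutes, sub_self, zero_mul]

/-- `φ` carries the ideal of `z - l` onto that of `z' - l'`, the two generators agreeing up to the
unit `s`, so it descends to the quotients. -/
theorem IsFibre.algEquiv {f' : FreeAlgebra k (Fin 2)} {B : Type v} [Semiring B] [Algebra k B]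
    {B' : Type w} [Semiring B'] [Algebra k B'] {l l' : k} {π : HomogAlg f →ₐ[k] B}
    {π' : HomogAlg f' →ₐ[k] B'} (h : IsFibre l π) (h' : IsFibre l' π')
    (φ : HomogAlg f ≃ₐ[k] HomogAlg f') {s : k} (hs : s ≠ 0)
    (hφ : φ (hz f - algebraMap k _ l) = s • (hz f' - algebraMap k _ l')) :
    Nonempty (B ≃ₐ[k] B') := by
  have key : ∀ g e, π g = π e ↔ π' (φ g) = π' (φ e) := by
    intro g e
    rw [h.eq_iff, h'.eq_iff, ← map_sub]
    constructor
    · rintro ⟨r, hr⟩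
      exact ⟨s • φ r, by rw [hr, map_mul, hφ, smul_mul_assoc, mul_smul_comm]⟩
    · rintro ⟨r, hr⟩
      refine ⟨s⁻¹ • φ.symm r, φ.injective ?_⟩
      rw [hr, map_mul, hφ, map_smul, AlgEquiv.apply_symm_apply, smul_mul_assoc, mul_smul_comm,
        smul_smul, mul_inv_cancel₀ hs, one_smul]
  have hr := Function.rightInverse_surjInv h.surjective
  have hinv : ∀ g, π' (φ (Function.surjInv h.surjective (π g))) = π' (φ g) :=
    fun g => (key _ _).1 (hr _)
  let F : B →ₐ[k] B' :=
    { toFun := fun y => π' (φ (Function.surjInv h.surjective y))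
      map_one' := by rw [← map_one π, hinv, map_one, map_one]
      map_mul' := by
        intro x y
        obtain ⟨x, rfl⟩ := h.surjective x
        obtain ⟨y, rfl⟩ := h.surjective y
        rw [← map_mul, hinv, hinv, hinv, map_mul, map_mul]
      map_zero' := by rw [← map_zero π, hinv, map_zero, map_zero]
      map_add' := by
        intro x y
        obtain ⟨x, rfl⟩ := h.surjective x
        obtain ⟨y, rfl⟩ := h.surjective y
        rw [← map_add, hinv, hinv, hinv, map_add, map_add]
      commutes' := by
        intro r
        rw [← AlgHom.commutes π, hinv, AlgEquiv.commutes, AlgHom.commutes] }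
  have hF : ∀ g, F (π g) = π' (φ g) := hinv
  refine ⟨AlgEquiv.ofBijective F ⟨?_, ?_⟩⟩
  · intro x y hxy
    obtain ⟨x, rfl⟩ := h.surjective x
    obtain ⟨y, rfl⟩ := h.surjective y
    rw [hF, hF] at hxy
    exact (key _ _).2 hxy
  · intro y
    obtain ⟨g, rfl⟩ := h'.surjective y
    exact ⟨π (φ.symm g), by rw [hF, AlgEquiv.apply_symm_apply]⟩

end Fibres

/-! ### The Rees algebra, the associated graded algebra and the center -/

section Graded

variable {k : Type u} [Field k] {f : FreeAlgebra k (Fin 2)} {a : Matrix (Fin 2) (Fin 2) k}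
  {b : Fin 2 → k} {c : k}

theorem gen_mem_filt_one (i : Fin 2) : gen f i ∈ filt k (gen f) 1 := by
  rw [filt, pow_one]
  exact Submodule.subset_span (.inr ⟨i, rfl⟩)

theorem one_mem_filt (n : ℕ) : (1 : Alg f) ∈ filt k (gen f) n := by
  rw [filt]
  have h : (1 : Submodule k (Alg f)) ≤ Submodule.span k (insert 1 (Set.range (gen f))) ^ n :=
    one_le_pow_of_one_le' (Submodule.one_le.2 (Submodule.subset_span (.inl rfl))) n
  exact Submodule.one_le.1 h

/-- The map from the homogenization to the associated graded algebra that kills `z`. -/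
theorem IsQuad.exists_toGr (hq : IsQuad f a b c) :
    ∃ ψ : HomogAlg f →ₐ[k] Gr f,
      (∀ i, ψ (hgen f i) = DirectSum.of _ 1 (grMk (gen f i) (gen_mem_filt_one i))) ∧
        ψ (hz f) = 0 := by
  apply hq.exists_hlift
  · intro i
    rw [mul_zero, zero_mul]
  · have hmem : ∀ i j, gen f i * gen f j ∈ filt k (gen f) 2 := fun i j =>
      mul_mem_filt k (gen f) (gen_mem_filt_one i) (gen_mem_filt_one j)
    have h1 : ∀ i j, DirectSum.of (GrPiece k (gen f)) 1 (grMk (gen f i) (gen_mem_filt_one i)) *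
        DirectSum.of _ 1 (grMk (gen f j) (gen_mem_filt_one j)) =
          DirectSum.of _ 2 (grMk (gen f i * gen f j) (hmem i j)) := by
      intro i j
      rw [DirectSum.of_mul_of]
      rfl
    have h2 := hq.quad_gen
    simp only [quad, Fin.sum_univ_two, mul_one] at h2
    simp only [quad, mul_zero, smul_zero, Finset.sum_const_zero, add_zero, h1, Fin.sum_univ_two,
      ← DirectSum.of_smul, ← map_add, grMk_smul, grMk_add]
    rw [← map_zero (DirectSum.of (GrPiece k (gen f)) 2)]
    congr 1
    rw [← grMk_zero, grMk_eq_iff, sub_zero]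
    -- In `A` the quadratic part of the relation equals minus its lower terms, which lie in `F_1`;
    -- hence its class in `F_2 / F_1` vanishes.
    rw [add_assoc, add_eq_zero_iff_eq_neg] at h2
    rw [h2]
    exact neg_mem (add_mem (add_mem (Submodule.smul_mem _ _ (gen_mem_filt_one 0))
      (Submodule.smul_mem _ _ (gen_mem_filt_one 1))) (Submodule.smul_mem _ _ (one_mem_filt 1)))

/-- Pairs of a homogeneous element `a t ^ n` of the Rees algebra and its class in the associated
graded algebra. -/
def reesGraphMonoid (f : FreeAlgebra k (Fin 2)) : Submonoid ((Alg f)[X] × Gr f) where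
  carrier := {p | ∃ (n : ℕ) (a : Alg f) (ha : a ∈ filt k (gen f) n),
    p = (monomial n a, DirectSum.of _ n (grMk a ha))}
  one_mem' := ⟨0, 1, one_mem_filt_zero _ _, rfl⟩
  mul_mem' := by
    rintro _ _ ⟨m, a, ha, rfl⟩ ⟨n, b, hb, rfl⟩
    refine ⟨m + n, a * b, mul_mem_filt _ _ ha hb, ?_⟩
    rw [Prod.mk_mul_mk, monomial_mul_monomial, DirectSum.of_mul_of]
    rfl

theorem coeff_of_mem_span_reesGraphMonoid {p : (Alg f)[X] × Gr f}
    (hp : p ∈ Submodule.span k (reesGraphMonoid f : Set ((Alg f)[X] × Gr f))) (n : ℕ) :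
    ∃ h : p.1.coeff n ∈ filt k (gen f) n, p.2 n = grMk (p.1.coeff n) h := by
  induction hp using Submodule.span_induction with
  | mem p hp =>
    obtain ⟨m, a, ha, rfl⟩ := hp
    by_cases hmn : m = n
    · subst hmn
      simp [ha]
    · simp [coeff_monomial, hmn, DirectSum.of_eq_of_ne, Ne.symm hmn, grMk_zero]
  | zero => simp [grMk_zero]
  | add p q _ _ hp hq =>
    obtain ⟨hp, hp'⟩ := hp
    obtain ⟨hq, hq'⟩ := hq
    simp only [Prod.fst_add, Prod.snd_add, coeff_add, DirectSum.add_apply, hp', hq', grMk_add]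
    simp [add_mem hp hq]
  | smul r p _ hp =>
    obtain ⟨hp, hp'⟩ := hp
    simp only [Prod.smul_fst, Prod.smul_snd, coeff_smul]
    exact ⟨Submodule.smul_mem _ r hp, by rw [DirectSum.smul_apply, hp', grMk_smul]⟩

/-- The pair `(θ, ψ)` sends the generators into `reesGraphMonoid f`, hence everything into its span.
So `ψ` is read off from `θ` by taking symbols of coefficients, which gives access to the kernel of
`ψ`. -/
theorem coeff_toRees {θ : HomogAlg f →ₐ[k] (Alg f)[X]} {ψ : HomogAlg f →ₐ[k] Gr f}
    (hθ : ∀ i, θ (hgen f i) = C (gen f i) * X) (hθz : θ (hz f) = X)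
    (hψ : ∀ i, ψ (hgen f i) = DirectSum.of _ 1 (grMk (gen f i) (gen_mem_filt_one i)))
    (hψz : ψ (hz f) = 0) (g : HomogAlg f) (n : ℕ) :
    ∃ h : (θ g).coeff n ∈ filt k (gen f) n, ψ g n = grMk ((θ g).coeff n) h := by
  apply coeff_of_mem_span_reesGraphMonoid (p := (θ.prod ψ) g)
  rw [← Submonoid.closure_eq (reesGraphMonoid f), ← Algebra.adjoin_eq_span]
  suffices h : (⊤ : Subalgebra k (HomogAlg f)) ≤
      (Algebra.adjoin k (reesGraphMonoid f : Set ((Alg f)[X] × Gr f))).comap (θ.prod ψ) from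
    h (Algebra.mem_top (x := g))
  rw [← adjoin_hgen, Algebra.adjoin_le_iff]
  rintro _ (rfl | ⟨i, rfl⟩)
  · refine Algebra.subset_adjoin ⟨1, 1, one_mem_filt 1, ?_⟩
    have h0 : grMk (1 : Alg f) (one_mem_filt 1) = 0 := by
      rw [← grMk_zero, grMk_eq_iff, sub_zero]
      exact one_mem_filt 0
    rw [h0, map_zero, monomial_one_one_eq_X]
    exact Prod.ext hθz hψz
  · refine Algebra.subset_adjoin ⟨1, gen f i, gen_mem_filt_one i, ?_⟩
    rw [← C_mul_X_eq_monomial]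
    exact Prod.ext (hθ i) (hψ i)

theorem monomial_mem_range_toRees {θ : HomogAlg f →ₐ[k] (Alg f)[X]}
    (hθ : ∀ i, θ (hgen f i) = C (gen f i) * X) (hθz : θ (hz f) = X) (n : ℕ) :
    ∀ a ∈ filt k (gen f) n, monomial n a ∈ θ.range := by
  induction n with
  | zero =>
    intro a ha
    rw [filt, pow_zero] at ha
    obtain ⟨r, rfl⟩ := Submodule.mem_one.1 ha
    exact ⟨algebraMap k _ r, AlgHom.commutes θ r⟩
  | succ n ih =>
    intro a ha
    rw [filt, pow_succ] at ha
    induction ha using Submodule.mul_induction_on' with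
    | mem_mul_mem a ha b hb =>
      rw [← monomial_mul_monomial]
      refine mul_mem (ih a ha) ?_
      induction hb using Submodule.span_induction with
      | mem b hb =>
        rcases hb with rfl | ⟨i, rfl⟩
        · exact ⟨hz f, by simp [hθz, monomial_one_one_eq_X]⟩
        · exact ⟨hgen f i, by simp [hθ, C_mul_X_eq_monomial]⟩
      | zero => simp
      | add x y _ _ hx hy => rw [map_add]; exact add_mem hx hy
      | smul r x _ hx =>
        rw [← smul_monomial]
        exact Subalgebra.smul_mem _ hx r
    | add x _ y _ hx hy => rw [map_add]; exact add_mem hx hy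

theorem mem_range_toRees {θ : HomogAlg f →ₐ[k] (Alg f)[X]}
    (hθ : ∀ i, θ (hgen f i) = C (gen f i) * X) (hθz : θ (hz f) = X) {p : (Alg f)[X]}
    (hp : ∀ n, p.coeff n ∈ filt k (gen f) n) : p ∈ θ.range := by
  rw [p.as_sum_support]
  exact sum_mem fun n _ => monomial_mem_range_toRees hθ hθz n _ (hp n)

/-- An element of the Rees algebra with zero symbols has its `n`-th coefficient in `F_{n-1}`, so it
is `t` times another element of the Rees algebra. Injectivity of `θ` brings this divisibility back
to the homogenization. -/
theorem IsQuad.exists_isFibre_gr (hq : IsQuad f a b c) {θ : HomogAlg f →ₐ[k] (Alg f)[X]}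
    (hθ : ∀ i, θ (hgen f i) = C (gen f i) * X) (hθz : θ (hz f) = X)
    (hinj : Function.Injective θ) :
    ∃ π : HomogAlg f →ₐ[k] Gr f, IsFibre 0 π := by
  obtain ⟨ψ, hψ, hψz⟩ := hq.exists_toGr
  have hc := coeff_toRees hθ hθz hψ hψz
  refine ⟨ψ, ?_, ?_⟩
  · intro x
    induction x using DirectSum.induction_on with
    | zero => exact ⟨0, map_zero ψ⟩
    | of n x =>
      obtain ⟨a, ha, rfl⟩ := exists_grMk x
      obtain ⟨g, hg⟩ := monomial_mem_range_toRees hθ hθz n a ha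
      replace hg : θ g = monomial n a := hg
      refine ⟨g, ?_⟩
      ext m
      obtain ⟨h, hm⟩ := hc g m
      rw [hm]
      by_cases hmn : n = m
      · subst hmn
        simp [hg]
      · simp [hg, coeff_monomial, hmn, DirectSum.of_eq_of_ne, Ne.symm hmn, grMk_zero]
    | add x y hx hy =>
      obtain ⟨x, rfl⟩ := hx
      obtain ⟨y, rfl⟩ := hy
      exact ⟨x + y, map_add ψ x y⟩
  · intro g h
    constructor
    · intro hgh
      have hlt : ∀ n, (θ (g - h)).coeff n ∈ filtLT k (gen f) n := by
        intro n
        obtain ⟨h1, h1'⟩ := hc g n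
        obtain ⟨h2, h2'⟩ := hc h n
        rw [map_sub, coeff_sub, ← grMk_eq_iff h1 h2, ← h1', ← h2', hgh]
      obtain ⟨e, he⟩ := mem_range_toRees hθ hθz (p := (θ (g - h)).divX) fun n => by
        rw [coeff_divX]
        exact hlt (n + 1)
      replace he : θ e = (θ (g - h)).divX := he
      refine ⟨e, hinj ?_⟩
      -- Here `F_{-1} = 0` is used: it leaves no constant term.
      have h0 : (θ (g - h)).coeff 0 = 0 := hlt 0
      rw [map_zero, sub_zero, map_mul, hθz, he]
      conv_lhs => rw [← X_mul_divX_add (θ (g - h)), h0, C_0, add_zero]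
    · rintro ⟨e, he⟩
      rw [sub_eq_iff_eq_add.1 he, map_add, map_mul, map_zero, sub_zero, hψz, zero_mul, zero_add]

theorem aeval_X_eq_map {A : Type v} [Ring A] [Algebra k A] (p : k[X]) :
    aeval (X : A[X]) p = p.map (algebraMap k A) := by
  induction p using Polynomial.induction_on' with
  | add p q hp hq => simp [hp, hq]
  | monomial n r =>
    rw [aeval_monomial, map_monomial, ← C_mul_X_pow_eq_monomial]
    rfl

/-- Comparing coefficients in the commutation with each `gen f i * X` shows that every coefficient
of `θ g` is central in `A`, hence a scalar. Thus `θ g` is a polynomial in `X = θ z` over `k`. -/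
theorem exists_aeval_of_mem_center {θ : HomogAlg f →ₐ[k] (Alg f)[X]}
    (hθ : ∀ i, θ (hgen f i) = C (gen f i) * X) (hθz : θ (hz f) = X)
    (hinj : Function.Injective θ) (hZ : Subalgebra.center k (Alg f) = ⊥) {g : HomogAlg f}
    (hg : g ∈ Subalgebra.center k (HomogAlg f)) : ∃ p : k[X], aeval (hz f) p = g := by
  have h1 : ∀ n, (θ g).coeff n ∈ Subalgebra.center k (Alg f) := by
    intro n
    have h2 : (⊤ : Subalgebra k (Alg f)) ≤ Subalgebra.centralizer k {(θ g).coeff n} := by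
      rw [← adjoin_gen, Algebra.adjoin_le_iff]
      rintro _ ⟨i, rfl⟩
      have h3 := congrArg (fun p => (θ p).coeff (n + 1)) (Subalgebra.mem_center_iff.1 hg (hgen f i))
      simp only [map_mul, hθ] at h3
      rw [mul_assoc, X_mul, ← mul_assoc, coeff_mul_X, coeff_C_mul, ← mul_assoc, coeff_mul_X,
        coeff_mul_C] at h3
      rintro _ rfl
      exact h3.symm
    rw [Subalgebra.mem_center_iff]
    intro y
    exact (h2 (Algebra.mem_top (x := y)) _ rfl).symm
  have h2 : θ g ∈ lifts (algebraMap k (Alg f)) := by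
    rw [lifts_iff_coeff_lifts]
    intro n
    have h3 := h1 n
    rw [hZ] at h3
    exact h3
  obtain ⟨p, hp⟩ := (mem_lifts _).1 h2
  refine ⟨p, hinj ?_⟩
  rw [← hp, ← aeval_algHom_apply, hθz]
  exact aeval_X_eq_map p

end Graded

/-! ### Injectivity criterion and normal forms -/

section Injectivity

variable {k : Type u} [Field k]

theorem linearIndependent_monomial {A : Type v} [Ring A] [Algebra k A] {ι : Type w} {e : ι → A}
    (he : LinearIndependent k e) :
    LinearIndependent k (fun p : Σ _ : ℕ, ι => (monomial p.1 (e p.2) : A[X])) := by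
  let L : A[X] →ₗ[k] (ℕ →₀ A) :=
    { toFun := fun p => p.toFinsupp.coeff
      map_add' := fun _ _ => by rw [toFinsupp_add]; rfl
      map_smul' := fun _ _ => by rw [toFinsupp_smul]; rfl }
  apply LinearIndependent.of_comp L
  exact Finsupp.linearIndependent_single (f := fun _ : ℕ => e) (fun _ => he)

theorem linearIndependent_of_map_eq_single {M : Type v} [AddCommGroup M] [Module k M] {ι : Type w}
    {e : ι → M} (L : M →ₗ[k] (ι →₀ k)) (h : ∀ i, L (e i) = Finsupp.single i 1) :
    LinearIndependent k e := by
  apply LinearIndependent.of_comp L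
  have h1 : L ∘ e = Finsupp.basisSingleOne (R := k) := by
    funext i
    simp [h]
  rw [h1]
  exact Module.Basis.linearIndependent _

/-- The spanning elements `z ^ n * h i` go to the monomials of degree `n + d i` with coefficient `e
i`. The pair `(n + d i, i)` determines `(n, i)`, so the images are independent. -/
theorem injective_of_basis {H : Type u} [Ring H] [Algebra k H] {A : Type v} [Ring A] [Algebra k A]
    {ι : Type w} (θ : H →ₐ[k] A[X]) {z : H} (hz : θ z = X) {h : ι → H} {e : ι → A} {d : ι → ℕ}
    (hθ : ∀ i, θ (h i) = monomial (d i) (e i)) (he : LinearIndependent k e)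
    (hspan : Submodule.span k (Set.range fun p : ℕ × ι => z ^ p.1 * h p.2) = ⊤) :
    Function.Injective θ := by
  have h1 : LinearIndependent k (fun p : ℕ × ι => θ (z ^ p.1 * h p.2)) := by
    convert (linearIndependent_monomial he).comp
      (fun p : ℕ × ι => (⟨p.1 + d p.2, p.2⟩ : Σ _ : ℕ, ι)) ?_ using 1
    · funext p
      simp [hz, hθ, X_pow_mul_monomial, add_comm]
    · rintro ⟨m, i⟩ ⟨n, j⟩ hmn
      obtain ⟨h1, h2⟩ := Sigma.mk.inj_iff.1 hmn
      obtain rfl := eq_of_heq h2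
      simpa using h1
  rw [injective_iff_map_eq_zero]
  intro x hx
  have hx' : x ∈ Submodule.span k (Set.range fun p : ℕ × ι => z ^ p.1 * h p.2) := by
    rw [hspan]; trivial
  obtain ⟨l, rfl⟩ := (Finsupp.mem_span_range_iff_exists_finsupp).1 hx'
  rw [linearIndependent_iff] at h1
  have h2 : l = 0 := h1 l (by
    rw [Finsupp.linearCombination_apply, ← hx, map_finsuppSum]
    simp)
  simp [h2]

theorem span_eq_top_of_mul_mem {H : Type v} [Ring H] [Algebra k H] {S : Submodule k H} {T : Set H}
    (hT : Algebra.adjoin k T = ⊤) (h1 : 1 ∈ S) (hS : ∀ t ∈ T, ∀ s ∈ S, t * s ∈ S) : S = ⊤ := by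
  have h2 : ∀ x ∈ Algebra.adjoin k T, ∀ s ∈ S, x * s ∈ S := by
    intro x hx
    induction hx using Algebra.adjoin_induction with
    | mem x hx => exact hS x hx
    | algebraMap r =>
      intro s hs
      rw [← Algebra.smul_def]
      exact S.smul_mem r hs
    | add x y _ _ hx hy => exact fun s hs => by rw [add_mul]; exact S.add_mem (hx s hs) (hy s hs)
    | mul x y _ _ hx hy => exact fun s hs => by rw [mul_assoc]; exact hx _ (hy s hs)
  rw [eq_top_iff]
  intro x _
  simpa using h2 x (hT ▸ Algebra.mem_top) 1 h1

theorem mul_mem_span_of_forall {H : Type v} [Ring H] [Algebra k H] {T : Set H} {x : H}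
    (h : ∀ t ∈ T, x * t ∈ Submodule.span k T) :
    ∀ s ∈ Submodule.span k T, x * s ∈ Submodule.span k T := by
  intro s hs
  induction hs using Submodule.span_induction with
  | mem t ht => exact h t ht
  | zero => simp
  | add s t _ _ hs ht => rw [mul_add]; exact add_mem hs ht
  | smul r s _ hs => rw [mul_smul_comm]; exact Submodule.smul_mem _ r hs

/-- The two normal forms of the leading coefficients. -/
theorem exists_normalForm [IsAlgClosed k] [CharZero k] {a : Matrix (Fin 2) (Fin 2) k}
    (ha : a ≠ 0) :
    ∃ P : Matrix (Fin 2) (Fin 2) k, IsUnit P ∧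
      (((P.transpose * a * P) 0 0 = 0 ∧ (P.transpose * a * P) 0 1 = 1) ∨
        P.transpose * a * P = !![1, 0; 0, 0]) := by
  have trans : ∀ (a P : Matrix (Fin 2) (Fin 2) k), IsUnit P →
      (∃ Q : Matrix (Fin 2) (Fin 2) k, IsUnit Q ∧
        (((Q.transpose * (P.transpose * a * P) * Q) 0 0 = 0 ∧
          (Q.transpose * (P.transpose * a * P) * Q) 0 1 = 1) ∨
            Q.transpose * (P.transpose * a * P) * Q = !![1, 0; 0, 0])) →
      ∃ P : Matrix (Fin 2) (Fin 2) k, IsUnit P ∧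
        (((P.transpose * a * P) 0 0 = 0 ∧ (P.transpose * a * P) 0 1 = 1) ∨
          P.transpose * a * P = !![1, 0; 0, 0]) := by
    rintro a P hP ⟨Q, hQ, h⟩
    refine ⟨P * Q, hP.mul hQ, ?_⟩
    rw [Matrix.transpose_mul]
    simpa only [Matrix.mul_assoc] using h
  have unit : ∀ p q r s : k, p * s - q * r ≠ 0 → IsUnit !![p, q; r, s] := by
    intro p q r s h
    rw [Matrix.isUnit_iff_isUnit_det, Matrix.det_fin_two_of]
    exact isUnit_iff_ne_zero.2 h
  have isotropic : ∀ a : Matrix (Fin 2) (Fin 2) k, a ≠ 0 → a 0 0 = 0 →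
      ∃ P : Matrix (Fin 2) (Fin 2) k, IsUnit P ∧
        (((P.transpose * a * P) 0 0 = 0 ∧ (P.transpose * a * P) 0 1 = 1) ∨
          P.transpose * a * P = !![1, 0; 0, 0]) := by
    intro a ha h00
    by_cases h01 : a 0 1 = 0
    · by_cases h10 : a 1 0 = 0
      · have h11 : a 1 1 ≠ 0 := by
          intro h11
          apply ha
          ext i j
          fin_cases i <;> fin_cases j <;> assumption
        obtain ⟨s, hs⟩ := IsAlgClosed.exists_pow_nat_eq (a 1 1) two_pos
        have hs0 : s ≠ 0 := by
          rintro rfl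
          exact h11 (by simpa using hs.symm)
        -- Only `a 1 1` survives: swap the variables and divide by its square root.
        refine ⟨!![0, 1; s⁻¹, 0], unit _ _ _ _ (by simp [hs0]), .inr ?_⟩
        ext i j
        fin_cases i <;> fin_cases j <;>
          simp [Matrix.mul_apply, Fin.sum_univ_two, h00, h01, h10, ← hs]
        field_simp
      -- The form is a product of two linear forms. The first column is the isotropic vector killed
      -- by the right factor, and the second scales the `(0, 1)` entry to `1`.
      · refine ⟨!![-a 1 1 / a 1 0, 1 / a 1 0; 1, 0], unit _ _ _ _ (by simp [h10]), .inl ?_⟩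
        constructor <;> simp [Matrix.mul_apply, Fin.sum_univ_two, h00, h01, h10]
        field_simp
        ring
    · refine ⟨!![1 / a 0 1, 0; 0, 1], unit _ _ _ _ (by simp [h01]), .inl ?_⟩
      constructor <;> simp [Matrix.mul_apply, Fin.sum_univ_two, h00, h01]
  by_cases h00 : a 0 0 = 0
  · exact isotropic a ha h00
  -- A root `t` of the quadratic form at `(t, 1)` gives an isotropic vector, taken as first basis
  -- vector.
  · obtain ⟨s, hs⟩ := IsAlgClosed.exists_eq_mul_self (discrim (a 0 0) (a 0 1 + a 1 0) (a 1 1))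
    obtain ⟨t, ht⟩ := exists_quadratic_eq_zero h00 ⟨s, hs⟩
    have hP : IsUnit !![t, 1; 1, (0 : k)] := unit _ _ _ _ (by simp)
    have hPt : IsUnit (!![t, 1; 1, (0 : k)]).transpose := (Matrix.isUnit_transpose _).2 hP
    refine trans a _ hP (isotropic _ ?_ ?_)
    · intro h0
      rw [hP.mul_left_eq_zero, hPt.mul_right_eq_zero] at h0
      exact ha h0
    · simp [Matrix.mul_apply, Fin.sum_univ_two]
      linear_combination ht

theorem quad_linear {a : Matrix (Fin 2) (Fin 2) k} {b : Fin 2 → k} {c : k} {B : Type v}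
    [Semiring B] [Algebra k B] (P : Matrix (Fin 2) (Fin 2) k) (y : Fin 2 → B) (z : B) :
    quad a b c (fun i => ∑ j, P i j • y j) z =
      quad (P.transpose * a * P) (P.transpose.mulVec b) c y z := by
  simp only [quad, Fin.sum_univ_two, Matrix.mul_apply, Matrix.transpose_apply, Matrix.mulVec,
    dotProduct, mul_add, add_mul, smul_mul_assoc, mul_smul_comm, smul_add, smul_smul]
  module

end Injectivity

/-! ### Linear changes of coordinates -/

section Coordinates

variable {k : Type u} [Field k] {f : FreeAlgebra k (Fin 2)} {a : Matrix (Fin 2) (Fin 2) k}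
  {b : Fin 2 → k} {c : k}

/-- Linear coordinates `Y` of the homogenization and `y` of the algebra in which the defining
relation has coefficients `a`, `b`, `c`. -/
structure IsCoordinates (f : FreeAlgebra k (Fin 2)) (a : Matrix (Fin 2) (Fin 2) k)
    (b : Fin 2 → k) (c : k) (Y : Fin 2 → HomogAlg f) (y : Fin 2 → Alg f) : Prop where
  quad_eq_zero : quad a b c Y (hz f) = 0
  quad_eq_zero' : quad a b c y 1 = 0
  exists_lift : ∀ {B : Type u} [Semiring B] [Algebra k B] (x : Fin 2 → B), quad a b c x 1 = 0 →
    ∃ φ : Alg f →ₐ[k] B, ∀ i, φ (y i) = x i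
  adjoin_eq_top : Algebra.adjoin k (insert (hz f) (Set.range Y)) = ⊤
  adjoin_eq_top' : Algebra.adjoin k (Set.range y) = ⊤
  toRees : ∀ θ : HomogAlg f →ₐ[k] (Alg f)[X], (∀ i, θ (hgen f i) = C (gen f i) * X) →
    ∀ i, θ (Y i) = C (y i) * X

theorem sum_smul_sum_smul {P Q : Matrix (Fin 2) (Fin 2) k} (h : P * Q = 1) {M : Type v}
    [AddCommMonoid M] [Module k M] (x : Fin 2 → M) (i : Fin 2) :
    ∑ j, P i j • ∑ l, Q j l • x l = x i := by
  have h1 : ∀ l, (P * Q) i l = (1 : Matrix (Fin 2) (Fin 2) k) i l := fun l => by rw [h]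
  simp only [Finset.smul_sum, smul_smul]
  rw [Finset.sum_comm]
  simp only [← Finset.sum_smul, ← Matrix.mul_apply, h1, Matrix.one_apply, ite_smul, one_smul,
    zero_smul, Finset.sum_ite_eq, Finset.mem_univ, if_true]

theorem IsQuad.exists_isCoordinates (hq : IsQuad f a b c) {P : Matrix (Fin 2) (Fin 2) k}
    (hP : IsUnit P) :
    ∃ Y y, IsCoordinates f (P.transpose * a * P) (P.transpose.mulVec b) c Y y := by
  obtain ⟨⟨P, Q, hPQ, hQP⟩, rfl⟩ := hP
  -- The new coordinates use `Q = P⁻¹`, so that the old generators are `P` applied to them.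
  refine ⟨fun j => ∑ i, Q j i • hgen f i, fun j => ∑ i, Q j i • gen f i, ?_, ?_, ?_, ?_, ?_, ?_⟩
  · rw [← quad_linear]
    simpa only [sum_smul_sum_smul hPQ] using hq.quad_hgen
  · rw [← quad_linear]
    simpa only [sum_smul_sum_smul hPQ] using hq.quad_gen
  · intro B _ _ x hx
    rw [← quad_linear] at hx
    obtain ⟨φ, hφ⟩ := hq.exists_lift _ hx
    refine ⟨φ, fun i => ?_⟩
    simp only [map_sum, map_smul, hφ]
    exact sum_smul_sum_smul hQP x i
  · rw [eq_top_iff, ← adjoin_hgen, Algebra.adjoin_le_iff]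
    rintro _ (rfl | ⟨i, rfl⟩)
    · exact Algebra.subset_adjoin (.inl rfl)
    · rw [← sum_smul_sum_smul hPQ (hgen f) i]
      exact sum_mem fun j _ => Subalgebra.smul_mem _ (Algebra.subset_adjoin (.inr ⟨j, rfl⟩)) _
  · rw [eq_top_iff, ← adjoin_gen, Algebra.adjoin_le_iff]
    rintro _ ⟨i, rfl⟩
    rw [← sum_smul_sum_smul hPQ (gen f) i]
    exact sum_mem fun j _ =>
      Subalgebra.smul_mem _ (Algebra.subset_adjoin (Set.mem_range_self j)) _
  · intro θ hθ i
    simp only [map_sum, map_smul, hθ, Finset.sum_mul, smul_C, ← smul_mul_assoc]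

end Coordinates

/-! ### First normal form: the basis `y ^ i x ^ j` -/

section Ore

variable {k : Type u} [Field k] {f : FreeAlgebra k (Fin 2)} {a : Matrix (Fin 2) (Fin 2) k}
  {b : Fin 2 → k} {c : k}

/-- The operator of left multiplication by `y` on the span of the monomials `y ^ i x ^ j`. -/
noncomputable def oreY (k : Type u) [Field k] : Module.End k (ℕ × ℕ →₀ k) :=
  Finsupp.lmapDomain k k fun p => (p.1 + 1, p.2)

/-- The product of `x` and `y ^ i x ^ j`, expressed in monomials `y ^ i x ^ j`. -/
noncomputable def oreVec (a : Matrix (Fin 2) (Fin 2) k) (b : Fin 2 → k) (c : k) : ℕ → ℕ → (ℕ × ℕ →₀ k)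
  | 0, j => Finsupp.single (0, j + 1) 1
  | i + 1, j => -(a 1 0 • oreY k (oreVec a b c i j) + a 1 1 • Finsupp.single (i + 2, j) 1 +
      b 0 • oreVec a b c i j + b 1 • Finsupp.single (i + 1, j) 1 + c • Finsupp.single (i, j) 1)

/-- The operator of left multiplication by `x` on the span of the monomials `y ^ i x ^ j`. -/
noncomputable def oreX (a : Matrix (Fin 2) (Fin 2) k) (b : Fin 2 → k) (c : k) : Module.End k (ℕ × ℕ →₀ k) :=
  Finsupp.linearCombination k fun p => oreVec a b c p.1 p.2

theorem oreY_single (p : ℕ × ℕ) :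
    oreY k (Finsupp.single p 1) = Finsupp.single (p.1 + 1, p.2) 1 := by
  simp [oreY]

theorem oreX_single (p : ℕ × ℕ) :
    oreX a b c (Finsupp.single p 1) = oreVec a b c p.1 p.2 := by
  simp [oreX]

/-- The recursion for `oreVec` is the relation solved for `xy`, so it holds on each basis vector.
This yields a representation of `A` that separates the monomials. -/
theorem quad_ore (h00 : a 0 0 = 0) (h01 : a 0 1 = 1) :
    quad a b c ![oreX a b c, oreY k] 1 = 0 := by
  apply Finsupp.lhom_ext'
  intro p
  apply LinearMap.ext_ring
  simp only [quad, Fin.sum_univ_two, h00, h01, LinearMap.comp_apply, Finsupp.lsingle_apply,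
    Matrix.cons_val_zero, Matrix.cons_val_one, mul_one, zero_smul, one_smul, zero_add,
    LinearMap.add_apply, LinearMap.smul_apply, Module.End.mul_apply, Module.End.one_apply,
    LinearMap.zero_apply, oreX_single, oreY_single, oreVec]
  abel

theorem ore_pow_apply (i j : ℕ) :
    (oreY k ^ i * oreX a b c ^ j) (Finsupp.single (0, 0) 1) = Finsupp.single (i, j) 1 := by
  rw [Module.End.mul_apply]
  have h1 : (oreX a b c ^ j) (Finsupp.single (0, 0) 1) = Finsupp.single (0, j) 1 := by
    induction j with
    | zero => simp
    | succ j ih => rw [pow_succ', Module.End.mul_apply, ih, oreX_single, oreVec]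
  rw [h1]
  induction i with
  | zero => simp
  | succ i ih => rw [pow_succ', Module.End.mul_apply, ih, oreY_single]

theorem ore_mul_mul {B : Type v} [Ring B] [Algebra k B] {Y : Fin 2 → B} {z : B}
    (h00 : a 0 0 = 0) (h01 : a 0 1 = 1) (hz : ∀ i, Commute z (Y i)) (hq : quad a b c Y z = 0)
    (v : B) : Y 0 * (Y 1 * v) = -(a 1 0 • (Y 1 * (Y 0 * v)) + a 1 1 • (Y 1 * (Y 1 * v)) +
      b 0 • (z * (Y 0 * v)) + b 1 • (z * (Y 1 * v)) + c • (z * (z * v))) := by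
  have h3 : Y 0 * Y 1 = -(a 1 0 • (Y 1 * Y 0) + a 1 1 • (Y 1 * Y 1) +
      b 0 • (z * Y 0) + b 1 • (z * Y 1) + c • (z * z)) := by
    simp only [quad, Fin.sum_univ_two, h00, h01, zero_smul, one_smul, zero_add, ← (hz _).eq] at hq
    rw [eq_neg_iff_add_eq_zero, ← hq]
    abel
  rw [← mul_assoc, h3]
  simp only [neg_mul, add_mul, smul_mul_assoc, mul_assoc]

/-- Applying the representation to the vector of the empty monomial gives independence in `A`.
Rewriting `xy` gives spanning in the homogenization, and `injective_of_basis` combines the two. -/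
theorem IsCoordinates.injective_of_ore {Y : Fin 2 → HomogAlg f} {y : Fin 2 → Alg f}
    (hY : IsCoordinates f a b c Y y) (h00 : a 0 0 = 0) (h01 : a 0 1 = 1)
    {θ : HomogAlg f →ₐ[k] (Alg f)[X]}
    (hθ : ∀ i, θ (hgen f i) = C (gen f i) * X) (hθz : θ (hz f) = X) :
    Function.Injective θ ∧ Nontrivial (Alg f) := by
  have hli : LinearIndependent k (fun p : ℕ × ℕ => y 1 ^ p.1 * y 0 ^ p.2) := by
    obtain ⟨φ, hφ⟩ := hY.exists_lift (B := Module.End k (ℕ × ℕ →₀ k))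
      ![oreX a b c, oreY k] (quad_ore h00 h01)
    refine linearIndependent_of_map_eq_single
      ((LinearMap.applyₗ (Finsupp.single ((0 : ℕ), (0 : ℕ)) (1 : k))).comp φ.toLinearMap) ?_
    intro p
    change φ (y 1 ^ p.1 * y 0 ^ p.2) (Finsupp.single (0, 0) 1) = _
    rw [map_mul, map_pow, map_pow, hφ, hφ]
    exact ore_pow_apply p.1 p.2
  refine ⟨?_, ⟨_, 0, hli.ne_zero (0, 0)⟩⟩
  refine injective_of_basis θ hθz (h := fun p : ℕ × ℕ => Y 1 ^ p.1 * Y 0 ^ p.2)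
    (d := fun p => p.1 + p.2) ?_ hli ?_
  · intro p
    have h1 : ∀ i n, (C (y i) * X) ^ n = (monomial n (y i ^ n) : (Alg f)[X]) := by
      intro i n
      rw [C_mul_X_eq_monomial, monomial_pow, one_mul]
    rw [map_mul, map_pow, map_pow, hY.toRees θ hθ, hY.toRees θ hθ, h1, h1, monomial_mul_monomial]
  · set S := Submodule.span k
      (Set.range fun p : ℕ × (ℕ × ℕ) => hz f ^ p.1 * (Y 1 ^ p.2.1 * Y 0 ^ p.2.2)) with hS
    have hz' : ∀ s ∈ S, hz f * s ∈ S := mul_mem_span_of_forall (by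
      rintro _ ⟨⟨n, i, j⟩, rfl⟩
      exact Submodule.subset_span ⟨⟨n + 1, i, j⟩, by simp [pow_succ', mul_assoc]⟩)
    have h1' : ∀ s ∈ S, Y 1 * s ∈ S := mul_mem_span_of_forall (by
      rintro _ ⟨⟨n, i, j⟩, rfl⟩
      refine Submodule.subset_span ⟨⟨n, i + 1, j⟩, ?_⟩
      simp only [pow_succ', ← mul_assoc, ((commute_hz (Y 1)).pow_left n).eq])
    have h0' : ∀ s ∈ S, Y 0 * s ∈ S := mul_mem_span_of_forall (by
      rintro _ ⟨⟨n, i, j⟩, rfl⟩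
      change Y 0 * (hz f ^ n * (Y 1 ^ i * Y 0 ^ j)) ∈ S
      have h2 : Y 0 * (hz f ^ n * (Y 1 ^ i * Y 0 ^ j)) =
          hz f ^ n * (Y 0 * (Y 1 ^ i * Y 0 ^ j)) := by
        rw [← mul_assoc, ← ((commute_hz (Y 0)).pow_left n).eq, mul_assoc]
      have hzn : ∀ s ∈ S, hz f ^ n * s ∈ S := by
        intro s hs
        induction n with
        | zero => simpa using hs
        | succ n ih => rw [pow_succ', mul_assoc]; exact hz' _ (ih (by
            rw [← mul_assoc, ← ((commute_hz (Y 0)).pow_left n).eq, mul_assoc]))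
      rw [h2]
      refine hzn _ ?_
      clear h2 hzn
      have hb : ∀ i, Y 1 ^ i * Y 0 ^ j ∈ S := fun i =>
        Submodule.subset_span ⟨⟨0, i, j⟩, by simp⟩
      -- Moving `x` past one `y` leaves terms with a smaller power of `y` to the right of `x`, or no
      -- `x` in front at all.
      induction i with
      | zero => exact Submodule.subset_span ⟨⟨0, 0, j + 1⟩, by simp [pow_succ']⟩
      | succ i ih =>
        rw [pow_succ', mul_assoc,
          ore_mul_mul h00 h01 (fun i => commute_hz (Y i)) hY.quad_eq_zero]
        refine S.neg_mem (S.add_mem (S.add_mem (S.add_mem (S.add_mem ?_ ?_) ?_) ?_) ?_) <;>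
          apply S.smul_mem
        exacts [h1' _ ih, h1' _ (h1' _ (hb i)), hz' _ ih, hz' _ (h1' _ (hb i)),
          hz' _ (hz' _ (hb i))])
    refine span_eq_top_of_mul_mem hY.adjoin_eq_top
      (Submodule.subset_span ⟨⟨0, 0, 0⟩, by simp⟩) ?_
    rintro _ (rfl | ⟨i, rfl⟩)
    · exact hz'
    · fin_cases i
      exacts [h0', h1']

end Ore

/-! ### Second normal form: words without `x ^ 2` -/

section FreeProduct

variable {k : Type u} [Field k] {f : FreeAlgebra k (Fin 2)} {b : Fin 2 → k} {c : k}

/-- The word `x ^ e₀ y x ^ e₁ y ⋯ y x ^ eₙ` with exponents `0` or `1`. -/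
def altWord {B : Type v} [Monoid B] (x y : B) : Bool → List Bool → B
  | e, [] => x ^ e.toNat
  | e, e' :: l => x ^ e.toNat * (y * altWord x y e' l)

/-- The length of the word `altWord x y e l`. -/
def altLength : Bool → List Bool → ℕ
  | e, [] => e.toNat
  | e, e' :: l => e.toNat + (1 + altLength e' l)

theorem altWord_true {B : Type v} [Monoid B] (x y : B) (l : List Bool) :
    altWord x y true l = x * altWord x y false l := by
  cases l <;> simp [altWord]

theorem altWord_cons {B : Type v} [Monoid B] (x y : B) (e : Bool) (l : List Bool) :
    altWord x y false (e :: l) = y * altWord x y e l := by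
  simp [altWord]

theorem map_altWord {B : Type v} [Monoid B] {D : Type w} [Monoid D] {F : Type*}
    [FunLike F B D] [MonoidHomClass F B D] (φ : F) (x y : B)
    (e : Bool) (l : List Bool) : φ (altWord x y e l) = altWord (φ x) (φ y) e l := by
  induction l generalizing e with
  | nil => simp [altWord]
  | cons e' l ih => simp [altWord, ih]

theorem altWord_C_mul_X {A : Type v} [Ring A] (x y : A) (e : Bool) (l : List Bool) :
    altWord (C x * X) (C y * X) e l = monomial (altLength e l) (altWord x y e l) := by
  have h1 : ∀ n, (C x * X) ^ n = (monomial n (x ^ n) : A[X]) := by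
    intro n
    rw [C_mul_X_eq_monomial, monomial_pow, one_mul]
  induction l generalizing e with
  | nil => simp [altWord, altLength, h1]
  | cons e' l ih =>
    rw [altWord, altWord, altLength, ih, h1, C_mul_X_eq_monomial, monomial_mul_monomial,
      monomial_mul_monomial]

/-- The operator of left multiplication by `y` on the span of the alternating words. -/
noncomputable def altY (k : Type u) [Field k] : Module.End k (Bool × List Bool →₀ k) :=
  Finsupp.lmapDomain k k fun p => (false, p.1 :: p.2)

/-- The operator of left multiplication by `x` on the span of the alternating words, where
`x ^ 2 + r x + c = 0`. -/
noncomputable def altX (r c : k) : Module.End k (Bool × List Bool →₀ k) :=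
  Finsupp.linearCombination k fun p => bif p.1 then
    -(r • Finsupp.single (true, p.2) 1 + c • Finsupp.single (false, p.2) 1)
    else Finsupp.single (true, p.2) 1

theorem altY_single (e : Bool) (l : List Bool) :
    altY k (Finsupp.single (e, l) 1) = Finsupp.single (false, e :: l) 1 := by
  simp [altY]

theorem altX_single_false (r c : k) (l : List Bool) :
    altX r c (Finsupp.single (false, l) 1) = Finsupp.single (true, l) 1 := by
  simp [altX]

theorem altX_single_true (r c : k) (l : List Bool) :
    altX r c (Finsupp.single (true, l) 1) =
      -(r • Finsupp.single (true, l) 1 + c • Finsupp.single (false, l) 1) := by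
  simp [altX]

theorem quad_alt (h1 : b 1 = 0) : quad !![1, 0; 0, 0] b c ![altX (b 0) c, altY k] 1 = 0 := by
  apply Finsupp.lhom_ext'
  rintro ⟨e, l⟩
  apply LinearMap.ext_ring
  simp only [quad, Fin.sum_univ_two, h1, LinearMap.comp_apply, Finsupp.lsingle_apply,
    Matrix.cons_val_zero, Matrix.cons_val_one, mul_one, zero_smul, one_smul, add_zero,
    LinearMap.add_apply, LinearMap.smul_apply, Module.End.mul_apply, Module.End.one_apply,
    LinearMap.zero_apply, Matrix.of_apply, Matrix.cons_val', Matrix.cons_val_fin_one]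
  cases e
  · simp only [altX_single_false, altX_single_true]
    abel
  · simp only [altX_single_false, altX_single_true, map_neg, map_add, map_smul]
    abel

theorem altWord_apply (r c : k) (e : Bool) (l : List Bool) :
    altWord (altX r c) (altY k) e l (Finsupp.single (false, []) 1) = Finsupp.single (e, l) 1 := by
  induction l generalizing e with
  | nil =>
    cases e
    · simp [altWord]
    · simp [altWord, altX_single_false]
  | cons e' l ih =>
    cases e
    · rw [altWord_cons, Module.End.mul_apply, ih, altY_single]
    · rw [altWord_true, altWord_cons, Module.End.mul_apply, Module.End.mul_apply, ih, altY_single,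
        altX_single_false]

theorem alt_mul_mul {B : Type v} [Ring B] [Algebra k B] {Y : Fin 2 → B} {z : B}
    (hb : b 1 = 0) (hz : ∀ i, Commute z (Y i)) (hq : quad !![1, 0; 0, 0] b c Y z = 0)
    (v : B) : Y 0 * (Y 0 * v) = -(b 0 • (z * (Y 0 * v)) + c • (z * (z * v))) := by
  have h3 : Y 0 * Y 0 = -(b 0 • (z * Y 0) + c • (z * z)) := by
    simp only [quad, Fin.sum_univ_two, hb, zero_smul, one_smul, add_zero, ← (hz _).eq,
      Matrix.of_apply, Matrix.cons_val', Matrix.cons_val_zero, Matrix.cons_val_one,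
      Matrix.cons_val_fin_one] at hq
    rw [eq_neg_iff_add_eq_zero, ← hq]
    abel
  rw [← mul_assoc, h3]
  simp only [neg_mul, add_mul, smul_mul_assoc, mul_assoc]

/-- With `b 1 = 0` the relation only rewrites `x ^ 2`, and the argument is as in the first normal
form. If `b 1 ≠ 0`, then `x` commutes with `yz`, so `z` kills `xy - yx` and injectivity fails. -/
theorem IsCoordinates.injective_of_freeProduct {Y : Fin 2 → HomogAlg f} {y : Fin 2 → Alg f}
    (hY : IsCoordinates f !![1, 0; 0, 0] b c Y y) (hb : b 1 = 0)
    {θ : HomogAlg f →ₐ[k] (Alg f)[X]}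
    (hθ : ∀ i, θ (hgen f i) = C (gen f i) * X) (hθz : θ (hz f) = X) :
    Function.Injective θ ∧ Nontrivial (Alg f) := by
  have hli : LinearIndependent k (fun p : Bool × List Bool => altWord (y 0) (y 1) p.1 p.2) := by
    obtain ⟨φ, hφ⟩ := hY.exists_lift (B := Module.End k (Bool × List Bool →₀ k))
      ![altX (b 0) c, altY k] (quad_alt hb)
    refine linearIndependent_of_map_eq_single
      ((LinearMap.applyₗ (Finsupp.single (false, ([] : List Bool)) (1 : k))).comp
        φ.toLinearMap) ?_
    intro p
    have h1 := map_altWord φ (y 0) (y 1) p.1 p.2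
    simp only [hφ] at h1
    change φ (altWord (y 0) (y 1) p.1 p.2) (Finsupp.single (false, []) 1) = _
    rw [h1]
    exact altWord_apply _ _ p.1 p.2
  refine ⟨?_, ⟨_, 0, hli.ne_zero (false, [])⟩⟩
  refine injective_of_basis θ hθz (h := fun p : Bool × List Bool => altWord (Y 0) (Y 1) p.1 p.2)
    (d := fun p => altLength p.1 p.2) ?_ hli ?_
  · intro p
    have h1 := map_altWord θ (Y 0) (Y 1) p.1 p.2
    simp only [hY.toRees θ hθ] at h1
    rw [h1, altWord_C_mul_X]
  · set S := Submodule.span k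
      (Set.range fun p : ℕ × (Bool × List Bool) =>
        hz f ^ p.1 * altWord (Y 0) (Y 1) p.2.1 p.2.2) with hS
    have hz' : ∀ s ∈ S, hz f * s ∈ S := mul_mem_span_of_forall (by
      rintro _ ⟨⟨n, e, l⟩, rfl⟩
      exact Submodule.subset_span ⟨⟨n + 1, e, l⟩, by simp [pow_succ', mul_assoc]⟩)
    have h1' : ∀ s ∈ S, Y 1 * s ∈ S := mul_mem_span_of_forall (by
      rintro _ ⟨⟨n, e, l⟩, rfl⟩
      refine Submodule.subset_span ⟨⟨n, false, e :: l⟩, ?_⟩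
      simp only [altWord_cons, ← mul_assoc, ((commute_hz (Y 1)).pow_left n).eq])
    have h0' : ∀ s ∈ S, Y 0 * s ∈ S := mul_mem_span_of_forall (by
      rintro _ ⟨⟨n, e, l⟩, rfl⟩
      cases e
      · refine Submodule.subset_span ⟨⟨n, true, l⟩, ?_⟩
        simp only [altWord_true, ← mul_assoc, ((commute_hz (Y 0)).pow_left n).eq]
      · have hmem : ∀ e, hz f ^ n * altWord (Y 0) (Y 1) e l ∈ S := fun e =>
          Submodule.subset_span ⟨⟨n, e, l⟩, rfl⟩
        have h5 : hz f ^ n * altWord (Y 0) (Y 1) true l =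
            Y 0 * (hz f ^ n * altWord (Y 0) (Y 1) false l) := by
          rw [altWord_true, ← mul_assoc, ((commute_hz (Y 0)).pow_left n).eq, mul_assoc]
        change Y 0 * (hz f ^ n * altWord (Y 0) (Y 1) true l) ∈ S
        rw [h5, alt_mul_mul hb (fun i => commute_hz (Y i)) hY.quad_eq_zero, ← h5]
        exact S.neg_mem (S.add_mem (S.smul_mem _ (hz' _ (hmem _)))
          (S.smul_mem _ (hz' _ (hz' _ (hmem _))))))
    refine span_eq_top_of_mul_mem hY.adjoin_eq_top
      (Submodule.subset_span ⟨⟨0, false, []⟩, by simp [altWord]⟩) ?_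
    rintro _ (rfl | ⟨i, rfl⟩)
    · exact hz'
    · fin_cases i
      exacts [h0', h1']

/-- If `b 1 ≠ 0`, the relation expresses `y` as a polynomial in `x`, so `x` is central. -/
theorem IsCoordinates.eq_zero_of_center_eq_bot {Y : Fin 2 → HomogAlg f} {y : Fin 2 → Alg f}
    (hY : IsCoordinates f !![1, 0; 0, 0] b c Y y) (hZ : Subalgebra.center k (Alg f) = ⊥) :
    b 1 = 0 := by
  by_contra hb
  have hy1 : y 1 = -((b 1)⁻¹) • (y 0 * y 0 + b 0 • y 0 + c • 1) := by
    have h4 := hY.quad_eq_zero'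
    simp only [quad, Fin.sum_univ_two, zero_smul, one_smul, add_zero, mul_one,
      Matrix.of_apply, Matrix.cons_val', Matrix.cons_val_zero,
      Matrix.cons_val_one, Matrix.cons_val_fin_one] at h4
    have h5 : y 0 * y 0 + b 0 • y 0 + c • 1 = -(b 1 • y 1) := by
      rw [eq_neg_iff_add_eq_zero, ← h4]
      abel
    rw [h5]
    match_scalars
    field_simp
  have hmem : y 0 ∈ Subalgebra.center k (Alg f) := by
    rw [Subalgebra.mem_center_iff]
    intro x
    have h2 : (⊤ : Subalgebra k (Alg f)) ≤ Subalgebra.centralizer k {y 0} := by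
      rw [← hY.adjoin_eq_top', Algebra.adjoin_le_iff]
      rintro _ ⟨i, rfl⟩ _ rfl
      fin_cases i
      · rfl
      · change y 0 * y 1 = y 1 * y 0
        rw [hy1]
        simp only [mul_smul_comm, smul_mul_assoc, mul_add, add_mul, mul_assoc, mul_one, one_mul]
    exact (h2 (Algebra.mem_top (x := x)) _ rfl).symm
  rw [hZ] at hmem
  obtain ⟨r, hr⟩ := Algebra.mem_bot.1 hmem
  -- A map to `k[X]` with `x ↦ X` shows that `x` is not a scalar.
  obtain ⟨φ, hφ⟩ := hY.exists_lift
    ![(X : k[X]), -((b 1)⁻¹) • (X * X + b 0 • X + c • 1)] (by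
      simp [quad, Fin.sum_univ_two, smul_smul, hb]
      abel)
  have h6 := hφ 0
  rw [← hr, AlgHom.commutes] at h6
  exact X_ne_C r h6.symm

end FreeProduct

/-! ### Isomorphisms and the central variable -/

section Center

variable {k : Type u} [Field k] {f : FreeAlgebra k (Fin 2)}

theorem exists_injective_toRees [IsAlgClosed k] [CharZero k] (hf : degree f = 2)
    (hZ : Subalgebra.center k (Alg f) = ⊥) :
    (∃ a b c, IsQuad f a b c) ∧ ∃ θ : HomogAlg f →ₐ[k] (Alg f)[X],
      (∀ i, θ (hgen f i) = C (gen f i) * X) ∧ θ (hz f) = X ∧ Function.Injective θ ∧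
        Nontrivial (Alg f) := by
  obtain ⟨a, b, c, ha, hq⟩ := exists_isQuad hf
  obtain ⟨θ, hθ, hθz⟩ := hq.exists_toRees
  refine ⟨⟨a, b, c, hq⟩, θ, hθ, hθz, ?_⟩
  obtain ⟨P, hP, h⟩ := exists_normalForm ha
  obtain ⟨Y, y, hY⟩ := hq.exists_isCoordinates hP
  rcases h with ⟨h00, h01⟩ | h
  · exact hY.injective_of_ore h00 h01 hθ hθz
  · rw [h] at hY
    exact hY.injective_of_freeProduct (hY.eq_zero_of_center_eq_bot hZ) hθ hθz

theorem aeval_hz_injective [Nontrivial (Alg f)] {θ : HomogAlg f →ₐ[k] (Alg f)[X]}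
    (hθz : θ (hz f) = X) : Function.Injective (aeval (R := k) (hz f)) := by
  rw [injective_iff_map_eq_zero]
  intro p hp
  have h1 : aeval (X : (Alg f)[X]) p = 0 := by
    rw [← hθz, aeval_algHom_apply, hp, map_zero]
  rw [aeval_X_eq_map] at h1
  exact (Polynomial.map_eq_zero _).1 h1

theorem map_mem_center {H : Type v} [Ring H] [Algebra k H] {H' : Type w} [Ring H'] [Algebra k H']
    (φ : H ≃ₐ[k] H') {g : H} (hg : ∀ h, Commute g h) :
    φ g ∈ Subalgebra.center k H' := by
  rw [Subalgebra.mem_center_iff]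
  intro y
  obtain ⟨y, rfl⟩ := φ.surjective y
  rw [← map_mul, ← map_mul, (hg y).eq]

/-- The polynomials describing `φ` and its inverse on the central variables compose to `X`, and
degrees multiply under composition, so both are linear. -/
theorem exists_eq_linear {H : Type v} [Ring H] [Algebra k H] {H' : Type w} [Ring H'] [Algebra k H']
    (φ : H ≃ₐ[k] H') {z : H} {z' : H'} (hinj : Function.Injective (aeval (R := k) z'))
    {p q : k[X]} (hp : aeval z' p = φ z) (hq : aeval z q = φ.symm z') :
    ∃ s t : k, s ≠ 0 ∧ φ z = s • z' + algebraMap k H' t := by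
  have h1 : q.comp p = X := by
    apply hinj
    rw [aeval_comp, hp, aeval_X, aeval_algHom_apply, hq, AlgEquiv.apply_symm_apply]
  have h2 : p.natDegree = 1 := by
    have h3 := congrArg natDegree h1
    rw [natDegree_comp, natDegree_X] at h3
    exact Nat.eq_one_of_mul_eq_one_left h3
  obtain ⟨s, hs, t, h4⟩ := natDegree_eq_one.1 h2
  refine ⟨s, t, hs, ?_⟩
  rw [← hp, ← h4]
  simp [Algebra.smul_def]

end Center

end TwoGen

/-! ### Matching the fibres -/

theorem mainTheorem8 {k : Type*} [Field k] [IsAlgClosed k] [CharZero k]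
    (f f' : FreeAlgebra k (Fin 2))
    (hf : TwoGen.degree f = 2) (hf' : TwoGen.degree f' = 2)
    (hZ : Subalgebra.center k (TwoGen.Alg f) = ⊥)
    (hZ' : Subalgebra.center k (TwoGen.Alg f') = ⊥)
    (hH : Nonempty (TwoGen.HomogAlg f ≃ₐ[k] TwoGen.HomogAlg f')) :
    (Nonempty (TwoGen.Alg f ≃ₐ[k] TwoGen.Alg f') ∧
        Nonempty (TwoGen.Gr f ≃ₐ[k] TwoGen.Gr f')) ∨
      (Nonempty (TwoGen.Alg f ≃ₐ[k] TwoGen.Gr f') ∧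
        Nonempty (TwoGen.Alg f' ≃ₐ[k] TwoGen.Gr f)) := by
  obtain ⟨φ⟩ := hH
  obtain ⟨⟨a, b, c, hq⟩, θ, hθ, hθz, hinj, -⟩ := TwoGen.exists_injective_toRees hf hZ
  obtain ⟨⟨a', b', c', hq'⟩, θ', hθ', hθz', hinj', hnt⟩ := TwoGen.exists_injective_toRees hf' hZ'
  obtain ⟨p, hp⟩ := TwoGen.exists_aeval_of_mem_center hθ' hθz' hinj' hZ'
    (TwoGen.map_mem_center φ TwoGen.commute_hz)
  obtain ⟨q, hq0⟩ := TwoGen.exists_aeval_of_mem_center hθ hθz hinj hZ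
    (TwoGen.map_mem_center φ.symm TwoGen.commute_hz)
  obtain ⟨s, t, hs, hst⟩ :=
    TwoGen.exists_eq_linear φ (TwoGen.aeval_hz_injective hθz') hp hq0
  -- The condition says `l = s l' + t`: the points `z = l` and `z' = l'` correspond.
  have key : ∀ l l' : k, t - l = -(s * l') →
      φ (TwoGen.hz f - algebraMap k _ l) = s • (TwoGen.hz f' - algebraMap k _ l') := by
    intro l l' h
    have h1 : algebraMap k (TwoGen.HomogAlg f') t - algebraMap k _ l =
        -(s • algebraMap k (TwoGen.HomogAlg f') l') := by
      rw [← map_sub, h, map_neg, map_mul, ← Algebra.smul_def]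
    rw [map_sub, hst, AlgEquiv.commutes, smul_sub, add_sub_assoc, h1, ← sub_eq_add_neg]
  obtain ⟨π₀, h₀⟩ := hq.exists_isFibre_gr hθ hθz hinj
  obtain ⟨π₀', h₀'⟩ := hq'.exists_isFibre_gr hθ' hθz' hinj'
  -- If `t = 0`, then `z = 1` matches `z' = s⁻¹` and the origins match. Otherwise `z = t` matches
  -- `z' = 0`, and `z = 0` matches `z' = -t / s ≠ 0`.
  by_cases ht : t = 0
  · left
    obtain ⟨π, h⟩ := hq.exists_isFibre_alg (l := 1) one_ne_zero
    obtain ⟨π', h'⟩ := hq'.exists_isFibre_alg (l := s⁻¹) (inv_ne_zero hs)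
    exact ⟨h.algEquiv h' φ hs (key _ _ (by simp [ht, hs])),
      h₀.algEquiv h₀' φ hs (key _ _ (by simp [ht]))⟩
  · right
    obtain ⟨π, h⟩ := hq.exists_isFibre_alg ht
    obtain ⟨π', h'⟩ := hq'.exists_isFibre_alg (l := -(t / s)) (neg_ne_zero.2 (div_ne_zero ht hs))
    refine ⟨h.algEquiv h₀' φ hs (key _ _ (by simp)), ?_⟩
    obtain ⟨e⟩ := h₀.algEquiv h' φ hs (key _ _ (by field_simp; simp))
    exact ⟨e.symm⟩
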